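/- Let $H$ be a (real or complex) Hilbert space with $3\le\dim H<\infty$, and let $L(H)$ be the orthomodular lattice of closed subspaces of $H$, with orthocomplement $P^\perp$. Write $P \mathbin{\&} Q = Q\wedge(P\vee Q^\perp)$ for the Sasaki projection, and call $P,Q$ compatible if $P=(P\wedge Q)\vee(P\wedge Q^\perp)$ (equivalently, if the orthogonal projections $\Pi_P$ and $\Pi_Q$ commute). Let $\mathfrak G=(A,M)$ be a directed graph labelled by $L(H)$, that is, a set $A$ with a relation $M\subseteq A\times L(H)\times A$. Say that $a\in A$ verifies $P\in L(H)$, written $a\Vdash P$, if there is no $b\in A$ with $M(a,P^\perp,b)$, and let $[a]=\{P\in L(H) : a\Vdash P\}$. Suppose that $\mathfrak G$ is a model of the theory $\mathcal T_{L(H)}$, which means that for all $a,b\in A$ and all $P,Q\in L(H)$: 1. $a\Vdash H$; 2. $a\not\Vdash\{0\}$; 3. if $P\neq H$, then some $c\in A$ satisfies $c\not\Vdash P$; 4. if $P\le Q$ and $a\Vdash P$, then $a\Vdash Q$; 5. if $a\Vdash P$ and $a\Vdash Q$, then $a\Vdash P\mathbin{\&}Q$; 6. if $a\Vdash P$ and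 $M(a,Q,b)$, then $b\Vdash P\mathbin{\&}Q$. Let $a\in A$. If $P$ and $Q$ are two distinct, incompatible elements of $[a]$, then neither $P$ nor $Q$ is minimal in $[a]$ with respect to inclusion. -/

import Mathlib

namespace QuantumMeasurement

/-- An orthomodular lattice: a bounded lattice with an orthocomplementation `ᶜ` satisfying the
orthomodular law. -/
class OrthomodularLattice (L : Type*) [Lattice L] [BoundedOrder L] extends Compl L where
  inf_compl_eq_bot : ∀ p : L, p ⊓ pᶜ = ⊥
  sup_compl_eq_top : ∀ p : L, p ⊔ pᶜ = ⊤
  compl_compl : ∀ p : L, pᶜᶜ = p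
  compl_le_compl : ∀ p q : L, p ≤ q → qᶜ ≤ pᶜ
  orthomodular : ∀ p q : L, p ≤ q → p ⊔ (q ⊓ pᶜ) = q

section Lattice

variable {L : Type*} [Lattice L] [BoundedOrder L] [OrthomodularLattice L]

/-- The Sasaki projection `p & q = q ∧ (p ∨ q^⊥)` (of `p` onto `q`). -/
def sasaki (p q : L) : L := q ⊓ (p ⊔ qᶜ)

/-- Compatibility of two elements of an orthomodular lattice. -/
def Compatible (p q : L) : Prop := p = (p ⊓ q) ⊔ (p ⊓ qᶜ)

variable {A : Type*}

/-- In the labelled directed graph `(A, M)`, where `M a p b` is an arrow from `a` to `b` labelled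
by `p` (measuring `a` can yield outcome `p` and leave `b`), the vertex `a` verifies `p` if outcome
`p^⊥` is impossible for `a`. -/
def Verifies (M : A → L → A → Prop) (a : A) (p : L) : Prop := ¬ ∃ b : A, M a pᶜ b

/-- The set of the properties verified by `a`. -/
def verifiedProperties (M : A → L → A → Prop) (a : A) : Set L := {p | Verifies M a p}

/-- The labelled directed graph `(A, M)` is a model of the theory `T_L`. -/
structure IsModel (M : A → L → A → Prop) : Prop where
  verifies_top : ∀ a, Verifies M a ⊤
  not_verifies_bot : ∀ a, ¬ Verifies M a ⊥
  exists_not_verifies : ∀ p : L, p ≠ ⊤ → ∃ a, ¬ Verifies M a p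
  verifies_mono : ∀ p q : L, p ≤ q → ∀ a, Verifies M a p → Verifies M a q
  verifies_sasaki : ∀ (p q : L) (a : A),
    Verifies M a p → Verifies M a q → Verifies M a (sasaki p q)
  preservation : ∀ (p q : L) (a b : A),
    Verifies M a p → M a q b → Verifies M b (sasaki p q)

end Lattice

/-- The Hilbert lattice `L(H)`: the closed subspaces of a Hilbert space `H`, ordered by inclusion
and with the orthogonal complement, form an orthomodular lattice. -/
instance hilbertLattice (𝕜 H : Type*) [RCLike 𝕜] [NormedAddCommGroup H] [InnerProductSpace 𝕜 H]
    [CompleteSpace H] : OrthomodularLattice (ClosedSubmodule 𝕜 H) :=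
  have key : ∀ p q : ClosedSubmodule 𝕜 H, p ≤ q → p ⊔ (q ⊓ p.orthogonal) = q := by
    intro p q hpq
    refine le_antisymm (sup_le hpq inf_le_left) ?_
    intro x hx
    have : CompleteSpace p.toSubmodule := p.isClosed.completeSpace_coe
    have h1 : p.toSubmodule.starProjection x ∈ p := p.toSubmodule.starProjection_apply_mem x
    have h2 : x - p.toSubmodule.starProjection x ∈ p.orthogonal :=
      p.toSubmodule.sub_starProjection_mem_orthogonal x
    have h3 : x - p.toSubmodule.starProjection x ∈ q ⊓ p.orthogonal :=
      ⟨q.toSubmodule.sub_mem hx (hpq h1), h2⟩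
    have h4 := (p ⊔ (q ⊓ p.orthogonal)).toSubmodule.add_mem
      ((le_sup_left : p ≤ p ⊔ (q ⊓ p.orthogonal)) h1)
      ((le_sup_right : q ⊓ p.orthogonal ≤ p ⊔ (q ⊓ p.orthogonal)) h3)
    rw [add_sub_cancel] at h4
    exact h4
  { compl := fun p => p.orthogonal
    inf_compl_eq_bot := fun p => p.inf_orthogonal_eq_bot
    sup_compl_eq_top := fun p => by simpa using key p ⊤ le_top
    compl_compl := fun p => by
      have : CompleteSpace p.toSubmodule := p.isClosed.completeSpace_coe
      exact ClosedSubmodule.toSubmodule_injective p.toSubmodule.orthogonal_orthogonal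
    compl_le_compl := fun _ _ h => ClosedSubmodule.orthogonal_le h
    orthomodular := key }

end QuantumMeasurement

namespace QuantumMeasurement

/-! ### Orthomodular lattices: compatibility and minimality -/

section Lattice

variable {L : Type*} [Lattice L] [BoundedOrder L] [OrthomodularLattice L]

/-! A minimal `Q` in `[a]` lies below every verified `P`, hence is compatible with it. By minimality
`Q ≤ P & Q`, so no nonzero vector of `Q` is orthogonal to a verified property. If `Q ≰ P`,
`exists_principal_vectors` gives a plane `R` on which `P` and `Q` induce distinct lines. An
`R`-successor of `a` would verify both lines, which `not_verifies_lines` excludes. So `a` verifies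
`Rᶜ`, although `R` contains a nonzero vector of `Q`: a contradiction.

Two distinct lines cannot both be verified because they force further lines (`verifies_line`), and
in dimension three the angle can be widened until two forced lines are orthogonal. -/

theorem compatible_of_le {p q : L} (h : p ≤ q) : Compatible p q := by
  rw [Compatible, inf_eq_left.2 h, sup_eq_left.2 inf_le_left]

theorem compatible_of_ge {p q : L} (h : q ≤ p) : Compatible p q := by
  rw [Compatible, inf_eq_right.2 h, OrthomodularLattice.orthomodular q p h]

/-- A minimal verified property is contained in the join of each verified property with
the complement of the minimal one. -/
theorem le_sup_compl_of_minimal {A : Type*} {M : A → L → A → Prop} (hM : IsModel M) {a : A}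
    {p q : L} (hp : Verifies M a p) (hq : Minimal (fun r => r ∈ verifiedProperties M a) q) :
    q ≤ p ⊔ qᶜ :=
  (hq.2 (hM.verifies_sasaki p q a hp hq.1) inf_le_left).trans inf_le_right

end Lattice

/-! ### Lines forced by two verified lines -/

section Hilbert

variable {𝕜 H : Type*} [RCLike 𝕜] [NormedAddCommGroup H] [InnerProductSpace 𝕜 H]

/-- The closed span of a set in a finite-dimensional space. -/
def closedSpan (𝕜 : Type*) {H : Type*} [RCLike 𝕜] [NormedAddCommGroup H] [InnerProductSpace 𝕜 H]
    [FiniteDimensional 𝕜 H] (s : Set H) : ClosedSubmodule 𝕜 H :=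
  ⟨Submodule.span 𝕜 s, Submodule.closed_of_finiteDimensional _⟩

section Span

variable [FiniteDimensional 𝕜 H]

theorem mem_closedSpan_singleton {u x : H} : x ∈ closedSpan 𝕜 {u} ↔ ∃ c : 𝕜, c • u = x :=
  Submodule.mem_span_singleton

theorem mem_closedSpan_pair {u v x : H} :
    x ∈ closedSpan 𝕜 {u, v} ↔ ∃ c d : 𝕜, c • u + d • v = x :=
  Submodule.mem_span_pair

theorem closedSpan_le {s : Set H} {P : ClosedSubmodule 𝕜 H} (h : s ⊆ P) : closedSpan 𝕜 s ≤ P :=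
  Submodule.span_le.2 h

end Span

variable [CompleteSpace H] {A : Type*} {M : A → ClosedSubmodule 𝕜 H → A → Prop}

theorem mem_compl_iff (P : ClosedSubmodule 𝕜 H) (v : H) :
    v ∈ Pᶜ ↔ ∀ u ∈ P, inner 𝕜 u v = 0 := Iff.rfl

/-- An element of `P ⊔ Q` is orthogonal to each vector orthogonal to both `P` and `Q`. -/
theorem inner_eq_zero_of_mem_sup {P Q : ClosedSubmodule 𝕜 H} {x y : H} (hx : x ∈ P ⊔ Q)
    (hP : y ∈ Pᶜ) (hQ : y ∈ Qᶜ) : inner 𝕜 x y = 0 := by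
  have h : P ⊔ Q ≤ ((P ⊔ Q)ᶜ)ᶜ := (OrthomodularLattice.compl_compl (P ⊔ Q)).ge
  have h2 : y ∈ (P ⊔ Q)ᶜ := by
    have := ClosedSubmodule.inf_orthogonal P Q
    change y ∈ (P ⊔ Q).orthogonal
    rw [← this]
    exact ⟨hP, hQ⟩
  exact h2 x hx

theorem not_verifies_of_le_compl (hM : IsModel M) {a : A} {P Q : ClosedSubmodule 𝕜 H}
    (hP : Verifies M a P) (hQ : Verifies M a Q) : ¬ P ≤ Qᶜ := by
  intro h
  have h1 := hM.verifies_sasaki P Q a hP hQ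
  have h2 : sasaki P Q = ⊥ := by
    rw [sasaki, sup_eq_right.2 h, OrthomodularLattice.inf_compl_eq_bot]
  exact hM.not_verifies_bot a (h2 ▸ h1)

/-- If the projections of `P` and `Q` to `Rᶜ` are orthogonal, then a vertex that verifies `P`
and `Q` verifies `R`. -/
theorem verifies_of_sasaki_le_compl (hM : IsModel M) {a : A} {P Q R : ClosedSubmodule 𝕜 H}
    (hP : Verifies M a P) (hQ : Verifies M a Q)
    (h : sasaki P Rᶜ ≤ (sasaki Q Rᶜ)ᶜ) : Verifies M a R := by
  rintro ⟨b, hb⟩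
  exact not_verifies_of_le_compl hM (hM.preservation P _ a b hP hb)
    (hM.preservation Q _ a b hQ hb) h

variable [FiniteDimensional 𝕜 H]

theorem mem_compl_closedSpan_singleton {u x : H} :
    x ∈ (closedSpan 𝕜 {u})ᶜ ↔ inner 𝕜 u x = 0 :=
  Submodule.mem_orthogonal_singleton_iff_inner_right

theorem not_verifies_orthogonal_lines (hM : IsModel M) {a : A} {u v : H}
    (hu : Verifies M a (closedSpan 𝕜 {u})) (hv : Verifies M a (closedSpan 𝕜 {v})) :
    inner 𝕜 u v ≠ 0 := by
  intro h
  refine not_verifies_of_le_compl hM hu hv (closedSpan_le ?_)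
  rw [Set.singleton_subset_iff]
  exact mem_compl_closedSpan_singleton.2 (inner_eq_zero_symm.1 h)

theorem exists_of_mem_sasaki_line {u r x : H}
    (hx : x ∈ sasaki (closedSpan 𝕜 {u}) (closedSpan 𝕜 {r})ᶜ) :
    inner 𝕜 r x = 0 ∧ ∃ c d : 𝕜, c • u + d • r = x := by
  refine ⟨mem_compl_closedSpan_singleton.1 hx.1, mem_closedSpan_pair.1 ?_⟩
  have h : closedSpan 𝕜 {u} ⊔ ((closedSpan 𝕜 {r})ᶜ)ᶜ ≤ closedSpan 𝕜 {u, r} := by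
    rw [OrthomodularLattice.compl_compl]
    exact sup_le (Submodule.span_mono (by simp)) (Submodule.span_mono (by simp))
  exact h hx.2

/-- The equation `h` says that the components of `u` and `v` orthogonal to `r` are orthogonal to
each other. -/
theorem verifies_line (hM : IsModel M) {a : A} {u v r : H}
    (hu : Verifies M a (closedSpan 𝕜 {u})) (hv : Verifies M a (closedSpan 𝕜 {v})) (hr : r ≠ 0)
    (h : inner 𝕜 u v * inner 𝕜 r r = inner 𝕜 u r * inner 𝕜 r v) :
    Verifies M a (closedSpan 𝕜 {r}) := by
  refine verifies_of_sasaki_le_compl hM hu hv fun x hx => ?_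
  rw [mem_compl_iff]
  intro y hy
  obtain ⟨hrx, c, d, rfl⟩ := exists_of_mem_sasaki_line hx
  obtain ⟨hry, c', d', rfl⟩ := exists_of_mem_sasaki_line hy
  have hrr : inner 𝕜 r r ≠ 0 := by simpa using hr
  rw [inner_eq_zero_symm]
  have hxr := inner_eq_zero_symm.1 hrx
  have : inner 𝕜 (c • u + d • r) (c' • v + d' • r) = c' * inner 𝕜 (c • u + d • r) v := by
    rw [inner_add_right, inner_smul_right, inner_smul_right, hxr]; ring
  rw [this]
  refine (mul_eq_zero.2 (Or.inr ((mul_left_inj' hrr).1 ?_)))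
  rw [inner_add_left, inner_smul_left, inner_smul_left] at hxr ⊢
  linear_combination (inner 𝕜 r v) * hxr + (starRingEnd 𝕜 c) * h

end Hilbert

/-! ### Uniqueness of a verified line in dimension at least three -/

section Frame

variable {𝕜 H : Type*} [RCLike 𝕜] [NormedAddCommGroup H] [InnerProductSpace 𝕜 H]

/-- The vector with the real coordinates `x`, `y`, `z` with respect to `e`. -/
def frameVector (𝕜 : Type*) {H : Type*} [RCLike 𝕜] [NormedAddCommGroup H] [InnerProductSpace 𝕜 H]
    (e : Fin 3 → H) (x y z : ℝ) : H :=
  (x : 𝕜) • e 0 + (y : 𝕜) • e 1 + (z : 𝕜) • e 2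

theorem inner_frameVector {e : Fin 3 → H} (he : Orthonormal 𝕜 e) (x y z x' y' z' : ℝ) :
    inner 𝕜 (frameVector 𝕜 e x y z) (frameVector 𝕜 e x' y' z') =
      ((x * x' + y * y' + z * z' : ℝ) : 𝕜) := by
  have h := orthonormal_iff_ite.1 he
  simp [frameVector, inner_add_left, inner_add_right, inner_smul_left, inner_smul_right, h, he.1]
  ring

theorem frameVector_ne_zero {e : Fin 3 → H} (he : Orthonormal 𝕜 e) {x y z : ℝ}
    (h : x * x + y * y + z * z ≠ 0) : frameVector 𝕜 e x y z ≠ 0 := by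
  intro h0
  have h1 := inner_frameVector (𝕜 := 𝕜) he x y z x y z
  rw [h0, inner_zero_left] at h1
  exact h (by exact_mod_cast h1.symm)

/-- There is a unit vector orthogonal to two given ones in dimension at least three. -/
theorem exists_orthonormal_extension [FiniteDimensional 𝕜 H]
    (hdim : 3 ≤ Module.finrank 𝕜 H) {u v : H} (hu : ‖u‖ = 1)
    (hv : ‖v‖ = 1) (huv : inner 𝕜 u v = 0) :
    ∃ e : Fin 3 → H, Orthonormal 𝕜 e ∧ e 0 = u ∧ e 1 = v := by
  have h : (Submodule.span 𝕜 {u, v})ᗮ ≠ ⊥ := by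
    intro h
    rw [Submodule.orthogonal_eq_bot_iff] at h
    have h1 : Module.finrank 𝕜 (Submodule.span 𝕜 {u, v}) ≤ 2 := by
      classical
      have := finrank_span_finset_le_card (R := 𝕜) ({u, v} : Finset H)
      rw [Finset.coe_pair] at this
      exact this.trans Finset.card_le_two
    rw [h, finrank_top] at h1
    omega
  obtain ⟨w, hw, hw0⟩ := Submodule.exists_mem_ne_zero_of_ne_bot h
  have hwu : inner 𝕜 u w = 0 := hw u (Submodule.subset_span (by simp))
  have hwv : inner 𝕜 v w = 0 := hw v (Submodule.subset_span (by simp))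
  refine ⟨![u, v, ((‖w‖⁻¹ : ℝ) : 𝕜) • w], ⟨?_, ?_⟩, rfl, rfl⟩
  · intro i
    fin_cases i
    · exact hu
    · exact hv
    · simp [norm_smul, hw0]
  · intro i j hij
    have hvu := inner_eq_zero_symm.1 huv
    have hwu' := inner_eq_zero_symm.1 hwu
    have hwv' := inner_eq_zero_symm.1 hwv
    fin_cases i <;> fin_cases j <;>
      simp_all [inner_smul_left, inner_smul_right]

variable [CompleteSpace H] [FiniteDimensional 𝕜 H] {A : Type*}
  {M : A → ClosedSubmodule 𝕜 H → A → Prop}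

theorem verifies_frameVector (hM : IsModel M) {a : A} {e : Fin 3 → H} (he : Orthonormal 𝕜 e)
    {s : ℝ} (hu : Verifies M a (closedSpan 𝕜 {frameVector 𝕜 e 1 s 0}))
    (hv : Verifies M a (closedSpan 𝕜 {frameVector 𝕜 e 1 (-s) 0})) {x y z : ℝ}
    (h0 : x * x + y * y + z * z ≠ 0)
    (h : (1 - s ^ 2) * (x * x + y * y + z * z) = x ^ 2 - s ^ 2 * y ^ 2) :
    Verifies M a (closedSpan 𝕜 {frameVector 𝕜 e x y z}) := by
  refine verifies_line hM hu hv (frameVector_ne_zero he h0) ?_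
  simp only [inner_frameVector he]
  norm_cast
  linear_combination h

/-- If `s ^ 2 ≥ 1 / 2`, two forced lines are already orthogonal. Otherwise a wider symmetric pair of
slope `z` is forced, with `1 / z ^ 2 = 1 / s ^ 2 - 1`; hence the induction on a bound `n` for `1 / s
^ 2`. -/
theorem not_verifies_symmetric_lines (hM : IsModel M) {a : A} (n : ℕ) :
    ∀ (e : Fin 3 → H) (_ : Orthonormal 𝕜 e) (s : ℝ), s ^ 2 ≤ 1 → 1 ≤ n * s ^ 2 →
      Verifies M a (closedSpan 𝕜 {frameVector 𝕜 e 1 s 0}) →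
      ¬ Verifies M a (closedSpan 𝕜 {frameVector 𝕜 e 1 (-s) 0}) := by
  induction n with
  | zero => intro e _ s _ h; norm_num at h
  | succ n ih =>
    intro e he s hs hn hu hv
    rcases le_or_gt (1 / 2) (s ^ 2) with hs2 | hs2
    · have hx := Real.sq_sqrt (show 0 ≤ s ^ 2 by positivity)
      have hy := Real.sq_sqrt (show 0 ≤ 2 * s ^ 2 - 1 by linarith)
      have hz := Real.sq_sqrt (show 0 ≤ 1 - s ^ 2 by linarith)
      set x := √(s ^ 2)
      set y := √(2 * s ^ 2 - 1)
      set z := √(1 - s ^ 2)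
      have h1 : Verifies M a (closedSpan 𝕜 {frameVector 𝕜 e x y z}) :=
        verifies_frameVector hM he hu hv (by nlinarith)
          (by linear_combination (-s ^ 2) * hx + hy + (1 - s ^ 2) * hz)
      have h2 : Verifies M a (closedSpan 𝕜 {frameVector 𝕜 e x (-y) (-z)}) :=
        verifies_frameVector hM he hu hv (by nlinarith)
          (by linear_combination (-s ^ 2) * hx + hy + (1 - s ^ 2) * hz)
      refine not_verifies_orthogonal_lines hM h1 h2 ?_
      rw [inner_frameVector he]
      norm_cast
      linear_combination hx - hy - hz
    · have hc : 0 < 1 - s ^ 2 := by linarith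
      have hz := Real.sq_sqrt (show 0 ≤ s ^ 2 / (1 - s ^ 2) by positivity)
      set z := √(s ^ 2 / (1 - s ^ 2))
      have hz' : z ^ 2 * (1 - s ^ 2) = s ^ 2 := by rw [hz]; field_simp
      have h1 : Verifies M a (closedSpan 𝕜 {frameVector 𝕜 e 1 0 z}) :=
        verifies_frameVector hM he hu hv (by nlinarith) (by linear_combination hz')
      have h2 : Verifies M a (closedSpan 𝕜 {frameVector 𝕜 e 1 0 (-z)}) :=
        verifies_frameVector hM he hu hv (by nlinarith) (by linear_combination hz')
      -- Exchanging the last two axes puts the new pair in the form required by the induction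
      -- hypothesis.
      have hswap (t : ℝ) : frameVector 𝕜 (e ∘ Equiv.swap 1 2) 1 t 0 = frameVector 𝕜 e 1 0 t := by
        have h3 : Equiv.swap (1 : Fin 3) 2 0 = 0 := by decide
        simp [frameVector, h3]
      refine ih (e ∘ Equiv.swap 1 2) (he.comp _ (Equiv.injective _)) z ?_ ?_ ?_ ?_
      · rw [hz, div_le_one hc]; linarith
      · rw [hz, mul_div_assoc', le_div_iff₀ hc]
        push_cast at hn
        linarith
      · rwa [hswap]
      · rwa [hswap]

/-- No vertex verifies two distinct lines. -/
theorem not_verifies_lines (hM : IsModel M) (hdim : 3 ≤ Module.finrank 𝕜 H) {a : A} {p q : H}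
    {c : ℝ} (hc : 0 ≤ c) (hpq : inner 𝕜 p q = (c : 𝕜)) (hp0 : p ≠ 0) (hq0 : q ≠ 0)
    (hne : (‖q‖ : 𝕜) • p ≠ (‖p‖ : 𝕜) • q) (hp : Verifies M a (closedSpan 𝕜 {p})) :
    ¬ Verifies M a (closedSpan 𝕜 {q}) := by
  intro hq
  -- Equal norms and a real inner product make `u + v` and `u - v` orthogonal; they span the first
  -- two axes. Then `c ≥ 0` gives `s ^ 2 ≤ 1`.
  set u := (‖q‖ : 𝕜) • p with hu
  set v := (‖p‖ : 𝕜) • q with hv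
  have hp1 : 0 < ‖p‖ := norm_pos_iff.2 hp0
  have hq1 : 0 < ‖q‖ := norm_pos_iff.2 hq0
  have hnu : ‖u‖ = ‖p‖ * ‖q‖ := by rw [hu, norm_smul]; simp [mul_comm]
  have hnv : ‖v‖ = ‖p‖ * ‖q‖ := by rw [hv, norm_smul]; simp
  have huv : inner 𝕜 u v = ((‖p‖ * ‖q‖ * c : ℝ) : 𝕜) := by
    rw [hu, hv, inner_smul_left, inner_smul_right, hpq]; simp; ring
  have hvu : inner 𝕜 v u = ((‖p‖ * ‖q‖ * c : ℝ) : 𝕜) := by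
    rw [← inner_conj_symm, huv, RCLike.conj_ofReal]
  have horth : inner 𝕜 (u + v) (u - v) = 0 := by
    rw [inner_sub_right, inner_add_left, inner_add_left, huv, hvu, inner_self_eq_norm_sq_to_K,
      inner_self_eq_norm_sq_to_K, hnu, hnv]
    ring
  have hD : 0 < ‖u - v‖ := norm_pos_iff.2 (sub_ne_zero.2 hne)
  have hS2 : ‖u + v‖ ^ 2 = ‖u - v‖ ^ 2 + 4 * (‖p‖ * ‖q‖ * c) := by
    rw [norm_add_sq (𝕜 := 𝕜), norm_sub_sq (𝕜 := 𝕜), huv, RCLike.ofReal_re]; ring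
  have hS : 0 < ‖u + v‖ := by
    have : 0 < ‖u + v‖ ^ 2 := by rw [hS2]; positivity
    exact (sq_pos_iff.1 this).lt_of_le' (norm_nonneg _)
  obtain ⟨e, he, he0, he1⟩ := exists_orthonormal_extension (𝕜 := 𝕜) hdim
    (u := ((‖u + v‖⁻¹ : ℝ) : 𝕜) • (u + v)) (v := ((‖u - v‖⁻¹ : ℝ) : 𝕜) • (u - v))
    (by rw [norm_smul]; simp [hS.ne']) (by rw [norm_smul]; simp [hD.ne'])
    (by rw [inner_smul_left, inner_smul_right, horth]; simp)
  have hSk : ((‖u + v‖ : ℝ) : 𝕜) ≠ 0 := by exact_mod_cast hS.ne'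
  have hDk : ((‖u - v‖ : ℝ) : 𝕜) ≠ 0 := by exact_mod_cast hD.ne'
  have hpk : ((‖p‖ : ℝ) : 𝕜) ≠ 0 := by exact_mod_cast hp1.ne'
  have hqk : ((‖q‖ : ℝ) : 𝕜) ≠ 0 := by exact_mod_cast hq1.ne'
  set s := ‖u - v‖ / ‖u + v‖ with hs
  have hfu : frameVector 𝕜 e 1 s 0 = ((2 * ‖u + v‖⁻¹ : ℝ) : 𝕜) • u := by
    rw [frameVector, he0, he1, hs]
    push_cast
    match_scalars <;> field_simp <;> ring
  have hfv : frameVector 𝕜 e 1 (-s) 0 = ((2 * ‖u + v‖⁻¹ : ℝ) : 𝕜) • v := by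
    rw [frameVector, he0, he1, hs]
    push_cast
    match_scalars <;> field_simp <;> ring
  have hs0 : 0 < s := div_pos hD hS
  have hs1 : s ^ 2 ≤ 1 := by
    rw [hs, div_pow, div_le_one (by positivity), hS2]
    have : 0 ≤ ‖p‖ * ‖q‖ * c := by positivity
    linarith
  obtain ⟨n, hn⟩ := exists_nat_ge (s ^ 2)⁻¹
  refine not_verifies_symmetric_lines hM (a := a) n e he s hs1 ?_ ?_ ?_
  · calc (1 : ℝ) = (s ^ 2)⁻¹ * s ^ 2 := by field_simp
      _ ≤ n * s ^ 2 := by gcongr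
  · refine hM.verifies_mono _ _ (closedSpan_le ?_) a hp
    rw [Set.singleton_subset_iff]
    refine mem_closedSpan_singleton.2 ⟨((‖u + v‖ / 2 * ‖q‖⁻¹ : ℝ) : 𝕜), ?_⟩
    have h : p = (‖q‖ : 𝕜)⁻¹ • u := by rw [hu, inv_smul_smul₀ hqk]
    rw [hfu, smul_smul, h]
    congr 1
    push_cast
    field_simp
  · refine hM.verifies_mono _ _ (closedSpan_le ?_) a hq
    rw [Set.singleton_subset_iff]
    refine mem_closedSpan_singleton.2 ⟨((‖u + v‖ / 2 * ‖p‖⁻¹ : ℝ) : 𝕜), ?_⟩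
    have h : q = (‖p‖ : 𝕜)⁻¹ • v := by rw [hv, inv_smul_smul₀ hpk]
    rw [hfv, smul_smul, h]
    congr 1
    push_cast
    field_simp

end Frame

/-! ### Principal vectors and minimal properties -/

section Minimality

variable {𝕜 H : Type*} [RCLike 𝕜] [NormedAddCommGroup H] [InnerProductSpace 𝕜 H]
  [FiniteDimensional 𝕜 H]

theorem exists_eigenvector_of_ne_zero {T : H →ₗ[𝕜] H} (hT : T.IsSymmetric) (h : T ≠ 0) :
    ∃ (μ : ℝ) (x : H), μ ≠ 0 ∧ x ≠ 0 ∧ T x = (μ : 𝕜) • x := by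
  by_contra! hcon
  refine h ((hT.eigenvectorBasis rfl).toBasis.ext fun i => ?_)
  have h1 := hT.apply_eigenvectorBasis rfl i
  have h0 := (hT.eigenvectorBasis rfl).orthonormal.ne_zero i
  by_cases hμ : hT.eigenvalues rfl i = 0
  · simp [hμ]
  · exact absurd h1 (hcon _ _ hμ h0)

variable [CompleteSpace H]

/-- Two subspaces `P`, `Q` with `Q` not contained in `P` and no nonzero vector of `Q` orthogonal
to `P` have a common invariant plane in which they induce two distinct lines. -/
theorem exists_principal_vectors {P Q : ClosedSubmodule 𝕜 H} (h : ¬ Q ≤ P)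
    (h0 : ∀ x ∈ Q, x ∈ Pᶜ → x = 0) :
    ∃ (p q : H) (l : ℝ), 0 < l ∧ l ≠ 1 ∧ q ∈ Q ∧ p ∈ P ∧ p ≠ 0 ∧ q - p ∈ Pᶜ ∧
      p - (l : 𝕜) • q ∈ Qᶜ := by
  set π := P.toSubmodule.starProjection
  set ρ := Q.toSubmodule.starProjection
  have hπ : ∀ x y, inner 𝕜 (π x) y = inner 𝕜 x (π y) :=
    fun x y => P.toSubmodule.inner_starProjection_left_eq_right x y
  have hρ : ∀ x y, inner 𝕜 (ρ x) y = inner 𝕜 x (ρ y) :=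
    fun x y => Q.toSubmodule.inner_starProjection_left_eq_right x y
  have hπ1 : ∀ x, π x ∈ P := fun x => P.toSubmodule.starProjection_apply_mem x
  have hρ1 : ∀ x, ρ x ∈ Q := fun x => Q.toSubmodule.starProjection_apply_mem x
  have hπ2 : ∀ x, x - π x ∈ Pᶜ := fun x => P.toSubmodule.sub_starProjection_mem_orthogonal x
  have hρ2 : ∀ x, x - ρ x ∈ Qᶜ := fun x => Q.toSubmodule.sub_starProjection_mem_orthogonal x
  have hρ3 : ∀ x ∈ Q, ρ x = x :=
    fun x hx => Submodule.starProjection_eq_self_iff.2 hx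
  -- The compression to `Q` of the projection onto `Pᶜ`. An eigenvector `q` with eigenvalue `μ ≠ 0`
  -- lies in `Q` and satisfies `ρ (π q) = (1 - μ) • q`.
  let T : H →ₗ[𝕜] H := (ρ ∘L (ContinuousLinearMap.id 𝕜 H - π) ∘L ρ : H →L[𝕜] H)
  have hTx : ∀ x, T x = ρ (ρ x - π (ρ x)) := fun x => rfl
  have hT : T.IsSymmetric := by
    intro x y
    rw [hTx, hTx, hρ, ← hρ x, inner_sub_left, inner_sub_right, hπ]
  have hT0 : T ≠ 0 := by
    intro hT0
    refine h fun x hx => ?_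
    have h1 : ρ (x - π x) = 0 := by
      have := hTx x
      rwa [hρ3 x hx, hT0, LinearMap.zero_apply, eq_comm] at this
    have h2 : inner 𝕜 x (x - π x) = 0 := by
      rw [← hρ3 x hx, hρ, hρ3 x hx, h1, inner_zero_right]
    have h3 : inner 𝕜 (π x) (x - π x) = 0 := hπ2 x _ (hπ1 x)
    have h4 : inner 𝕜 (x - π x) (x - π x) = 0 := by rw [inner_sub_left, h2, h3, sub_zero]
    rw [inner_self_eq_zero, sub_eq_zero] at h4
    rw [h4]
    exact hπ1 x
  obtain ⟨μ, q, hμ, hq, hTq⟩ := exists_eigenvector_of_ne_zero hT hT0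
  have hμk : (μ : 𝕜) ≠ 0 := by exact_mod_cast hμ
  have hqQ : q ∈ Q := by
    have : q = (μ : 𝕜)⁻¹ • T q := by rw [hTq, inv_smul_smul₀ hμk]
    rw [this]
    exact Q.toSubmodule.smul_mem _ (hρ1 _)
  have hρπ : ρ (π q) = ((1 - μ : ℝ) : 𝕜) • q := by
    rw [hTx, hρ3 q hqQ, map_sub, hρ3 q hqQ, sub_eq_iff_eq_add] at hTq
    push_cast
    rw [sub_smul, one_smul, eq_sub_iff_add_eq, add_comm]
    exact hTq.symm
  have hp0 : π q ≠ 0 := fun hp => hq (h0 q hqQ (by simpa [hp] using hπ2 q))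
  refine ⟨π q, q, 1 - μ, ?_, by simpa using hμ, hqQ, hπ1 q, hp0, hπ2 q, ?_⟩
  · have h1 : inner 𝕜 (π q) (π q) = ((1 - μ : ℝ) : 𝕜) * inner 𝕜 q q := by
      have h2 : inner 𝕜 (π q) (q - π q) = 0 := hπ2 q _ (hπ1 q)
      rw [inner_sub_right, sub_eq_zero] at h2
      rw [← h2]
      nth_rewrite 2 [← hρ3 q hqQ]
      rw [← hρ, hρπ, inner_smul_left, RCLike.conj_ofReal]
    rw [inner_self_eq_norm_sq_to_K, inner_self_eq_norm_sq_to_K] at h1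
    have h2 : ‖π q‖ ^ 2 = (1 - μ) * ‖q‖ ^ 2 := by exact_mod_cast h1
    have h3 : 0 < ‖π q‖ ^ 2 := by positivity
    rw [h2] at h3
    exact pos_of_mul_pos_left h3 (by positivity)
  · rw [← hρπ]
    exact hρ2 _

variable {A : Type*} {M : A → ClosedSubmodule 𝕜 H → A → Prop}

/-- In a plane spanned by `p` and a vector `d` orthogonal to `P` and `p`, the projection of `P`
lies on the line of `p`. -/
theorem sasaki_le_line {P R : ClosedSubmodule 𝕜 H} {p d : H} (hd : d ≠ 0) (hdP : d ∈ Pᶜ)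
    (hdR : d ∈ R) (hpd : inner 𝕜 p d = 0) (hR : R ≤ closedSpan 𝕜 {p, d}) :
    sasaki P R ≤ closedSpan 𝕜 {p} := by
  intro x hx
  obtain ⟨c, c', rfl⟩ := mem_closedSpan_pair.1 (hR hx.1)
  have h1 : inner 𝕜 (c • p + c' • d) d = 0 := by
    refine inner_eq_zero_of_mem_sup hx.2 hdP ?_
    rw [OrthomodularLattice.compl_compl]
    exact hdR
  rw [inner_add_left, inner_smul_left, inner_smul_left, hpd, mul_zero, zero_add, mul_eq_zero,
    inner_self_eq_zero, or_iff_left hd, map_eq_zero] at h1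
  exact mem_closedSpan_singleton.2 ⟨c, by rw [h1, zero_smul, add_zero]⟩

theorem not_minimal_of_not_le (hdim : 3 ≤ Module.finrank 𝕜 H) (hM : IsModel M) {a : A}
    {P Q : ClosedSubmodule 𝕜 H} (hP : Verifies M a P) (h : ¬ Q ≤ P) :
    ¬ Minimal (fun R => R ∈ verifiedProperties M a) Q := by
  intro hQ
  -- Such an `x` lies in `R ⊔ Qᶜ` but is orthogonal to both summands.
  have key : ∀ R, Verifies M a R → ∀ x ∈ Q, x ∈ Rᶜ → x = 0 := by
    intro R hR x hx hxR
    refine inner_self_eq_zero (𝕜 := 𝕜).1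
      (inner_eq_zero_of_mem_sup (le_sup_compl_of_minimal hM hR hQ hx) hxR ?_)
    rwa [OrthomodularLattice.compl_compl]
  obtain ⟨p, q, l, hl0, hl1, hqQ, hpP, hp0, hd, hd'⟩ := exists_principal_vectors h (key P hP)
  have hlk : (l : 𝕜) ≠ 0 := by exact_mod_cast hl0.ne'
  have hlk1 : (l : 𝕜) ≠ 1 := by exact_mod_cast hl1
  have hpp : inner 𝕜 p q = inner 𝕜 p p := by
    have := hd p hpP
    rwa [inner_sub_right, sub_eq_zero] at this
  have hqp : inner 𝕜 q p = l * inner 𝕜 q q := by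
    have := hd' q hqQ
    rwa [inner_sub_right, inner_smul_right, sub_eq_zero] at this
  have hq0 : q ≠ 0 := by
    rintro rfl
    rw [inner_zero_right, eq_comm, inner_self_eq_zero] at hpp
    exact hp0 hpp
  have hqq : inner 𝕜 q q ≠ 0 := by simpa using hq0
  have hpq : inner 𝕜 p q = ((‖p‖ ^ 2 : ℝ) : 𝕜) := by
    rw [hpp, inner_self_eq_norm_sq_to_K]; push_cast; rfl
  have hqp' : inner 𝕜 q p = inner 𝕜 p q := by
    rw [← inner_conj_symm, hpq, RCLike.conj_ofReal]
  -- `p` and `q` are linearly independent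
  have hind : ∀ c : 𝕜, c • p ≠ q := by
    rintro c rfl
    have hc : c = 1 := by
      rw [inner_smul_right] at hpp
      exact mul_right_cancel₀ (b := inner 𝕜 p p) (by simpa using hp0) (by rw [hpp, one_mul])
    subst hc
    rw [one_smul] at hqp hqq
    exact hlk1 (mul_right_cancel₀ hqq (by rw [← hqp, one_mul]))
  have hd0 : q - p ≠ 0 := fun h0 => hind 1 (by rw [one_smul, sub_eq_zero.1 h0])
  have hd0' : p - (l : 𝕜) • q ≠ 0 := by
    intro h0
    refine hind (l : 𝕜)⁻¹ ?_
    rw [sub_eq_zero.1 h0, inv_smul_smul₀ hlk]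
  set R := closedSpan 𝕜 {p, q}
  -- `R` is also spanned by `p` and `q - p ∈ Pᶜ`, and by `q` and `p - l • q ∈ Qᶜ`, so
  -- `sasaki_le_line` applies to both properties.
  have hR : Verifies M a Rᶜ := by
    rintro ⟨b, hb⟩
    rw [OrthomodularLattice.compl_compl] at hb
    have h1 : Verifies M b (closedSpan 𝕜 {p}) := by
      refine hM.verifies_mono _ _ (sasaki_le_line hd0 hd ?_ (hd p hpP) ?_) b
        (hM.preservation P R a b hP hb)
      · exact mem_closedSpan_pair.2 ⟨-1, 1, by module⟩
      · refine closedSpan_le ?_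
        rintro x (rfl | rfl)
        · exact mem_closedSpan_pair.2 ⟨1, 0, by module⟩
        · exact mem_closedSpan_pair.2 ⟨1, 1, by module⟩
    have h2 : Verifies M b (closedSpan 𝕜 {q}) := by
      refine hM.verifies_mono _ _ (sasaki_le_line hd0' hd' ?_ (hd' q hqQ) ?_) b
        (hM.preservation Q R a b hQ.1 hb)
      · exact mem_closedSpan_pair.2 ⟨1, -(l : 𝕜), by module⟩
      · refine closedSpan_le ?_
        rintro x (rfl | rfl)
        · exact mem_closedSpan_pair.2 ⟨l, 1, by module⟩
        · exact mem_closedSpan_pair.2 ⟨1, 0, by module⟩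
    refine not_verifies_lines hM hdim (by positivity) hpq hp0 hq0 ?_ h1 h2
    intro h3
    have hpk : (‖p‖ : 𝕜) ≠ 0 := by simpa using hp0
    exact hind ((‖p‖ : 𝕜)⁻¹ * ‖q‖) (by rw [mul_smul, h3, inv_smul_smul₀ hpk])
  refine hq0 (key _ hR q hqQ ?_)
  rw [OrthomodularLattice.compl_compl]
  exact mem_closedSpan_pair.2 ⟨0, 1, by module⟩

end Minimality

end QuantumMeasurement

theorem mainTheorem5 {𝕜 H : Type*} [RCLike 𝕜] [NormedAddCommGroup H] [InnerProductSpace 𝕜 H]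
    [CompleteSpace H] [FiniteDimensional 𝕜 H] (hdim : 3 ≤ Module.finrank 𝕜 H)
    {A : Type*} (M : A → ClosedSubmodule 𝕜 H → A → Prop) (hM : QuantumMeasurement.IsModel M)
    (a : A) (P Q : ClosedSubmodule 𝕜 H)
    (hP : P ∈ QuantumMeasurement.verifiedProperties M a)
    (hQ : Q ∈ QuantumMeasurement.verifiedProperties M a)
    (hne : P ≠ Q) (hPQ : ¬ QuantumMeasurement.Compatible P Q) :
    ¬ Minimal (fun R => R ∈ QuantumMeasurement.verifiedProperties M a) P ∧
      ¬ Minimal (fun R => R ∈ QuantumMeasurement.verifiedProperties M a) Q := by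
  exact ⟨QuantumMeasurement.not_minimal_of_not_le hdim hM hQ
      fun h => hPQ (QuantumMeasurement.compatible_of_le h),
    QuantumMeasurement.not_minimal_of_not_le hdim hM hP
      fun h => hPQ (QuantumMeasurement.compatible_of_ge h)⟩
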